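/- Let $\mathbb N=\{0,1,2,\dots\}$ and order $\mathbb N^2$ componentwise, so that $\alpha\wedge\beta=(\min(\alpha_1,\beta_1),\min(\alpha_2,\beta_2))$ is the infimum of $\alpha$ and $\beta$. Write $\alpha\ll\beta$ if $\alpha_1<\beta_1$ and $\alpha_2<\beta_2$, and $\alpha\le\le\beta$ if $\alpha=\beta$ or $\alpha\ll\beta$. Let $S\subseteq\mathbb N^2$ be a local good semigroup, i.e. a submonoid of $(\mathbb N^2,+)$ such that - (G1) $\alpha\wedge\beta\in S$ for all $\alpha,\beta\in S$; - (G2) if $\alpha,\beta\in S$ and $\alpha_i=\beta_i$ for some $i\in\{1,2\}$, and $j$ is the other index, then there is $\delta\in S$ with $\delta_i>\alpha_i=\beta_i$, $\delta_j\ge\min\{\alpha_j,\beta_j\}$, and $\delta_j=\min\{\alpha_j,\beta_j\}$ if $\alpha_j\ne\beta_j$; - (G3) there is $c\in S$ with $c+\mathbb N^2\subseteq S$; - (local) $(0,0)$ is the only element of $S$ with a zero component. Let $e=(e_1,e_2)$ be the smallest nonzero element of $S$, and let $\mathbf{Ap}(S)=\{\alpha\in S:\alpha-e\notin S\}$ be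 its Apéry set. Define recursively, for $i\ge1$: $B^{(i)}$ is the set of elements of $\mathbf{Ap}(S)\setminus\bigcup_{1\le j<i}D^{(j)}$ that are maximal in that set with respect to $\le\le$; $C^{(i)}$ is the set of $\alpha\in B^{(i)}$ such that $\alpha=\beta_1\wedge\beta_2$ for some $\beta_1,\beta_2\in B^{(i)}\setminus\{\alpha\}$; and $D^{(i)}=B^{(i)}\setminus C^{(i)}$. There is an $N$ with $\mathbf{Ap}(S)=\bigcup_{i=1}^{N}D^{(i)}$. Let $N$ be the least such number (the number of levels), and put $A_i=D^{(N+1-i)}$ for $1\le i\le N$, so that $\mathbf{Ap}(S)=\bigcup_{i=1}^N A_i$. **Proposition.** Let $2\le i\le N$ and $\alpha\in A_i$. Then there exists $\beta\in A_{i-1}$ such that $\beta\le\alpha$. -/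

import Mathlib

namespace GoodSemigroup

/-- A local good subsemigroup of `ℕ²`: a submonoid `S` of `(ℕ², +)` that is closed under infima,
has the exchange property in both components and contains a translate of `ℕ²`, and whose only
element with a zero component is `0`.  On `ℕ × ℕ`, `≤` is the componentwise order and
`⊓` is the componentwise minimum. -/
structure IsLocalGood (S : AddSubmonoid (ℕ × ℕ)) : Prop where
  /-- closure under infima -/
  inf_mem : ∀ α ∈ S, ∀ β ∈ S, α ⊓ β ∈ S
  /-- the exchange property for the first component -/
  exchange_fst : ∀ α ∈ S, ∀ β ∈ S, α.1 = β.1 →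
    ∃ δ ∈ S, α.1 < δ.1 ∧ min α.2 β.2 ≤ δ.2 ∧ (α.2 ≠ β.2 → δ.2 = min α.2 β.2)
  /-- the exchange property for the second component -/
  exchange_snd : ∀ α ∈ S, ∀ β ∈ S, α.2 = β.2 →
    ∃ δ ∈ S, α.2 < δ.2 ∧ min α.1 β.1 ≤ δ.1 ∧ (α.1 ≠ β.1 → δ.1 = min α.1 β.1)
  /-- `S` contains a translate of `ℕ²` -/
  exists_conductor : ∃ c ∈ S, ∀ δ : ℕ × ℕ, c + δ ∈ S
  /-- `S` is local -/
  isLocal : ∀ α ∈ S, α.1 = 0 ∨ α.2 = 0 → α = 0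

/-- The vector `e = (e₁, e₂)` of the smallest components of nonzero elements of `S`.  For a local
good semigroup this is the smallest nonzero element of `S`, see `isLeast_minElt`. -/
noncomputable def minElt (S : AddSubmonoid (ℕ × ℕ)) : ℕ × ℕ :=
  (sInf {x | ∃ α ∈ S, α ≠ 0 ∧ α.1 = x}, sInf {y | ∃ α ∈ S, α ≠ 0 ∧ α.2 = y})

theorem isLeast_minElt {S : AddSubmonoid (ℕ × ℕ)} (hS : IsLocalGood S) :
    IsLeast {α | α ∈ S ∧ α ≠ 0} (minElt S) := by
  obtain ⟨c, -, hc⟩ := hS.exists_conductor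
  have hne : c + (1, 1) ≠ 0 := by
    intro h
    have := congrArg Prod.fst h
    simp at this
  have h1 : {x | ∃ α ∈ S, α ≠ 0 ∧ α.1 = x}.Nonempty := ⟨_, _, hc (1, 1), hne, rfl⟩
  have h2 : {y | ∃ α ∈ S, α ≠ 0 ∧ α.2 = y}.Nonempty := ⟨_, _, hc (1, 1), hne, rfl⟩
  obtain ⟨a, ha, ha0, ha1⟩ := Nat.sInf_mem h1
  obtain ⟨b, hb, hb0, hb2⟩ := Nat.sInf_mem h2
  have hlow : ∀ α ∈ S, α ≠ 0 → minElt S ≤ α := fun α hα h0 =>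
    Prod.mk_le_mk.2 ⟨Nat.sInf_le ⟨α, hα, h0, rfl⟩, Nat.sInf_le ⟨α, hα, h0, rfl⟩⟩
  have hinf : minElt S = a ⊓ b := by
    refine le_antisymm (le_inf (hlow a ha ha0) (hlow b hb hb0)) ?_
    refine Prod.mk_le_mk.2 ⟨?_, ?_⟩
    · exact inf_le_left.trans ha1.le
    · exact inf_le_right.trans hb2.le
  refine ⟨⟨hinf ▸ hS.inf_mem a ha b hb, fun h => ?_⟩, fun α hα => hlow α hα.1 hα.2⟩
  have h0 : a.1 = 0 := ha1.trans (congrArg Prod.fst h)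
  exact ha0 (hS.isLocal a ha (Or.inl h0))

/-- The Apéry set `Ap(S) = {α ∈ S : α - e ∉ S}` with respect to the smallest nonzero element `e`
(the difference being taken in `ℤ²`). -/
def apery (S : AddSubmonoid (ℕ × ℕ)) : Set (ℕ × ℕ) :=
  {α | α ∈ S ∧ ¬ ∃ σ ∈ S, σ + minElt S = α}

/-- `α ≪ β`: strict inequality in both components. -/
def StrictDom (α β : ℕ × ℕ) : Prop := α.1 < β.1 ∧ α.2 < β.2

/-- `α ≤≤ β`: `α = β` or `α ≪ β`. -/
def DomLE (α β : ℕ × ℕ) : Prop := α = β ∨ (α ≠ β ∧ StrictDom α β)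

/-- The elements of `X` that are maximal in `X` with respect to `≤≤`. -/
def maximalPart (X : Set (ℕ × ℕ)) : Set (ℕ × ℕ) :=
  {α | α ∈ X ∧ ∀ β ∈ X, DomLE α β → β = α}

/-- The elements `α` of `maximalPart X` that are the infimum of two elements of
`maximalPart X \ {α}`. -/
def infPart (X : Set (ℕ × ℕ)) : Set (ℕ × ℕ) :=
  {α | α ∈ maximalPart X ∧
    ∃ β₁ ∈ maximalPart X \ {α}, ∃ β₂ ∈ maximalPart X \ {α}, α = β₁ ⊓ β₂}

/-- The part of `X` that is removed at one step. -/
def topPart (X : Set (ℕ × ℕ)) : Set (ℕ × ℕ) := maximalPart X \ infPart X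

/-- `residual S k` is `Ap(S)` with the first `k` layers removed, see `residual_eq`. -/
def residual (S : AddSubmonoid (ℕ × ℕ)) : ℕ → Set (ℕ × ℕ)
  | 0 => apery S
  | k + 1 => residual S k \ topPart (residual S k)

/-- The layers `D⁽ⁱ⁾`, `i ≥ 1`, numbered from the top: `D⁽ⁱ⁾ = B⁽ⁱ⁾ \ C⁽ⁱ⁾`, where `B⁽ⁱ⁾` is the
maximal part of `Ap(S) \ ⋃_{j < i} D⁽ʲ⁾` and `C⁽ⁱ⁾` is the set of those elements of `B⁽ⁱ⁾` that are
infima of two other ones.  There is no layer of index `0`. -/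
def layer (S : AddSubmonoid (ℕ × ℕ)) : ℕ → Set (ℕ × ℕ)
  | 0 => ∅
  | k + 1 => topPart (residual S k)

theorem residual_eq (S : AddSubmonoid (ℕ × ℕ)) (k : ℕ) :
    residual S k = apery S \ ⋃ j ∈ Finset.Icc 1 k, layer S j := by
  induction k with
  | zero => simp [residual]
  | succ k ih =>
    have h : Finset.Icc 1 (k + 1) = insert (k + 1) (Finset.Icc 1 k) := by
      ext x
      simp only [Finset.mem_Icc, Finset.mem_insert]
      omega
    have h' : residual S (k + 1) = residual S k \ layer S (k + 1) := rfl
    rw [h', ih, h, Finset.set_biUnion_insert, Set.sdiff_sdiff, Set.union_comm]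

/-- The number `N` of levels: the least `N` with `Ap(S) = ⋃_{1 ≤ i ≤ N} D⁽ⁱ⁾`. For a local good
semigroup there is such an `N`, see `numLevels_spec`. -/
noncomputable def numLevels (S : AddSubmonoid (ℕ × ℕ)) : ℕ :=
  sInf {N | apery S = ⋃ j ∈ Finset.Icc 1 N, layer S j}

/-- The levels in increasing order: `A_i = D^(N + 1 - i)` for `1 ≤ i ≤ N`. (For `i = 0` and for
`i > N` this set is empty.) -/
noncomputable def level (S : AddSubmonoid (ℕ × ℕ)) (i : ℕ) : Set (ℕ × ℕ) :=
  layer S (numLevels S + 1 - i)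

theorem mem_maximalPart {X : Set (ℕ × ℕ)} {α : ℕ × ℕ} :
    α ∈ maximalPart X ↔ α ∈ X ∧ ∀ β ∈ X, ¬ StrictDom α β := by
  refine and_congr_right fun _ => forall₂_congr fun β _ => ⟨fun h hd => ?_, fun h hd => ?_⟩
  · have hne : α ≠ β := by
      rintro rfl
      exact lt_irrefl _ hd.1
    exact hne (h (Or.inr ⟨hne, hd⟩)).symm
  · rcases hd with hd | hd
    · exact hd.symm
    · exact absurd hd.2 h

/-- An element that is maximal at some step is removed at that step or at the next one. -/
theorem not_mem_of_mem_maximalPart {X Y : Set (ℕ × ℕ)} (hY : Y = X \ topPart X) {α : ℕ × ℕ}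
    (hα : α ∈ maximalPart X) : α ∉ Y \ topPart Y := by
  rintro ⟨hαY, hαn⟩
  have hYX : Y ⊆ X := by
    rw [hY]
    exact Set.sdiff_subset
  have hmax := (mem_maximalPart.1 hα).2
  have hαYm : α ∈ maximalPart Y := mem_maximalPart.2 ⟨hαY, fun β hβ => hmax β (hYX hβ)⟩
  have hαi : α ∈ infPart Y := by
    by_contra h
    exact hαn ⟨hαYm, h⟩
  obtain ⟨-, γ, ⟨hγ, hγα⟩, γ', -, hinf⟩ := hαi
  have hαγ : α ≤ γ := hinf ▸ inf_le_left
  have hγY : γ ∈ X \ topPart X := hY ▸ hγ.1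
  have hγm : γ ∈ maximalPart X := mem_maximalPart.2 ⟨hγY.1, fun δ hδ hd =>
    hmax δ hδ ⟨hαγ.1.trans_lt hd.1, hαγ.2.trans_lt hd.2⟩⟩
  have hγi : γ ∈ infPart X := by
    by_contra h
    exact hγY.2 ⟨hγm, h⟩
  obtain ⟨-, η, ⟨hη, hηγ⟩, η', ⟨hη', hηγ'⟩, hinf'⟩ := hγi
  have h1 := hmax η hη.1
  have h2 := hmax η' hη'.1
  have e1 : γ.1 = min η.1 η'.1 := congrArg Prod.fst hinf'
  have e2 : γ.2 = min η.2 η'.2 := congrArg Prod.snd hinf'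
  have l1 := hαγ.1
  have l2 := hαγ.2
  simp only [Set.mem_singleton_iff, Prod.ext_iff, StrictDom] at hγα hηγ hηγ' h1 h2
  omega

theorem numLevels_spec {S : AddSubmonoid (ℕ × ℕ)} (hS : IsLocalGood S) :
    apery S = ⋃ j ∈ Finset.Icc 1 (numLevels S), layer S j := by
  have hsub : ∀ k, residual S k ⊆ apery S := fun k => by
    rw [residual_eq]
    exact Set.sdiff_subset
  have hlay : ∀ k, (⋃ j ∈ Finset.Icc 1 k, layer S j) ⊆ apery S := fun k => by
    refine Set.iUnion₂_subset fun j _ => ?_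
    cases j with
    | zero => exact Set.empty_subset _
    | succ j => exact fun x hx => hsub j hx.1.1
  have hchain : ∀ n, ∀ α ∈ residual S (2 * n), ∃ β ∈ apery S, α.1 + n ≤ β.1 ∧ α.2 + n ≤ β.2 := by
    intro n
    induction n with
    | zero => exact fun α hα => ⟨α, hα, le_rfl, le_rfl⟩
    | succ n ih =>
      intro α hα
      have hα' : α ∈ residual S (2 * n) := hα.1.1
      have hnm : α ∉ maximalPart (residual S (2 * n)) := fun h =>
        not_mem_of_mem_maximalPart (Y := residual S (2 * n + 1)) rfl h hα
      rw [mem_maximalPart] at hnm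
      push Not at hnm
      obtain ⟨β, hβ, hd⟩ := hnm hα'
      obtain ⟨δ, hδ, h1, h2⟩ := ih β hβ
      have d1 := hd.1
      have d2 := hd.2
      exact ⟨δ, hδ, by omega, by omega⟩
  obtain ⟨c, -, hc⟩ := hS.exists_conductor
  have hbound : ∀ β ∈ apery S, ¬ c + minElt S ≤ β := by
    rintro β ⟨-, hβ⟩ hle
    obtain ⟨δ, rfl⟩ := exists_add_of_le hle
    exact hβ ⟨c + δ, hc δ, by abel⟩
  have hex : ∃ N, apery S = ⋃ j ∈ Finset.Icc 1 N, layer S j := by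
    let n := (c + minElt S).1 + (c + minElt S).2
    refine ⟨2 * n, Set.Subset.antisymm ?_ (hlay _)⟩
    rw [← Set.sdiff_eq_empty, ← residual_eq, Set.eq_empty_iff_forall_notMem]
    intro α hα
    obtain ⟨β, hβ, h1, h2⟩ := hchain n α hα
    refine hbound β hβ ⟨?_, ?_⟩
    · omega
    · omega
  exact Nat.sInf_mem hex

end GoodSemigroup

namespace GoodSemigroup

/-! The layers are the level sets of a monotone height. A unit step of a lattice path counts if the
half-line issuing from its start, perpendicular to the step, meets `S` but not `S + e`; exchange
makes the count independent of the path (`step_comm`, `jump_comm`). Below any element of `S` the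
height takes every intermediate value on the Apéry set (`exists_mem_apery_height_eq`). The recursive
peeling removes one height at a time, starting from the largest (`topPart_height_lt`,
`mem_layer_succ`). Hence an element of the level below is an Apéry element `≤ α` with height one
less. -/

/-- `T` has a point `(x, z)` with `y ≤ z`. -/
def MeetsVert (T : Set (ℕ × ℕ)) (x y : ℕ) : Prop := ∃ z, y ≤ z ∧ (x, z) ∈ T

/-- `T` has a point `(z, y)` with `x ≤ z`. -/
def MeetsHorz (T : Set (ℕ × ℕ)) (x y : ℕ) : Prop := ∃ z, x ≤ z ∧ (z, y) ∈ T

/-- The exchange property (G2) in the strict case, for a subset of `ℕ²`. -/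
structure Exchange (T : Set (ℕ × ℕ)) : Prop where
  fst : ∀ x y z, y < z → (x, y) ∈ T → (x, z) ∈ T → ∃ w, x < w ∧ (w, y) ∈ T
  snd : ∀ x y z, x < z → (x, y) ∈ T → (z, y) ∈ T → ∃ w, y < w ∧ (x, w) ∈ T

open Classical in
/-- Exchanging the order of a horizontal and a vertical unit step does not change the number of
half-lines that meet `T`. -/
theorem Exchange.step_comm {T : Set (ℕ × ℕ)} (hT : Exchange T) (x y : ℕ) :
    (if MeetsVert T x y then 1 else 0) + (if MeetsHorz T (x + 1) y then 1 else 0) =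
      (if MeetsHorz T x y then 1 else 0) + (if MeetsVert T x (y + 1) then 1 else 0) := by
  have hV : MeetsVert T x y ↔ (x, y) ∈ T ∨ MeetsVert T x (y + 1) := by
    constructor
    · rintro ⟨z, hz, h⟩
      rcases hz.eq_or_lt with rfl | hz
      · exact Or.inl h
      · exact Or.inr ⟨z, hz, h⟩
    · rintro (h | ⟨z, hz, h⟩)
      · exact ⟨y, le_rfl, h⟩
      · exact ⟨z, by omega, h⟩
  have hH : MeetsHorz T x y ↔ (x, y) ∈ T ∨ MeetsHorz T (x + 1) y := by
    constructor
    · rintro ⟨z, hz, h⟩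
      rcases hz.eq_or_lt with rfl | hz
      · exact Or.inl h
      · exact Or.inr ⟨z, hz, h⟩
    · rintro (h | ⟨z, hz, h⟩)
      · exact ⟨x, le_rfl, h⟩
      · exact ⟨z, by omega, h⟩
  by_cases hp : (x, y) ∈ T
  · have hiff : MeetsHorz T (x + 1) y ↔ MeetsVert T x (y + 1) := by
      constructor
      · rintro ⟨z, hz, h⟩
        exact hT.snd x y z hz hp h
      · rintro ⟨z, hz, h⟩
        exact hT.fst x y z hz hp h
    simp only [hV, hH, hp, true_or, if_true, hiff]
  · simp only [hV, hH, hp, false_or]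
    exact add_comm _ _

theorem IsLocalGood.exchange {S : AddSubmonoid (ℕ × ℕ)} (hS : IsLocalGood S) :
    Exchange (S : Set (ℕ × ℕ)) where
  fst x y z hyz h1 h2 := by
    obtain ⟨⟨a, b⟩, hδ, hlt, -, heq⟩ := hS.exchange_fst _ h1 _ h2 rfl
    have hb : b = y := (heq hyz.ne).trans (min_eq_left hyz.le)
    exact ⟨a, hlt, hb ▸ hδ⟩
  snd x y z hxz h1 h2 := by
    obtain ⟨⟨a, b⟩, hδ, hlt, -, heq⟩ := hS.exchange_snd _ h1 _ h2 rfl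
    have ha : a = x := (heq hxz.ne).trans (min_eq_left hxz.le)
    exact ⟨b, hlt, ha ▸ hδ⟩

/-- The ideal `S + e`, whose complement in `S` is the Apéry set. -/
def shift (S : AddSubmonoid (ℕ × ℕ)) : Set (ℕ × ℕ) := {α | ∃ σ ∈ S, σ + minElt S = α}

theorem mem_apery {S : AddSubmonoid (ℕ × ℕ)} {α : ℕ × ℕ} :
    α ∈ apery S ↔ α ∈ S ∧ α ∉ shift S := Iff.rfl

theorem IsLocalGood.exchange_shift {S : AddSubmonoid (ℕ × ℕ)} (hS : IsLocalGood S) :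
    Exchange (shift S) where
  fst := by
    rintro x y z hyz ⟨⟨a, b⟩, h1, h1'⟩ ⟨⟨a', b'⟩, h2, h2'⟩
    simp only [Prod.ext_iff, Prod.fst_add, Prod.snd_add] at h1' h2'
    obtain rfl : a = a' := by omega
    obtain ⟨w, hw, h⟩ := hS.exchange.fst a b b' (by omega) h1 h2
    exact ⟨w + (minElt S).1, by omega, (w, b), h, Prod.ext rfl h1'.2⟩
  snd := by
    rintro x y z hxz ⟨⟨a, b⟩, h1, h1'⟩ ⟨⟨a', b'⟩, h2, h2'⟩
    simp only [Prod.ext_iff, Prod.fst_add, Prod.snd_add] at h1' h2'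
    obtain rfl : b = b' := by omega
    obtain ⟨w, hw, h⟩ := hS.exchange.snd a b a' (by omega) h1 h2
    exact ⟨w + (minElt S).2, by omega, (a, w), h, Prod.ext h1'.1 rfl⟩

theorem IsLocalGood.shift_subset {S : AddSubmonoid (ℕ × ℕ)} (hS : IsLocalGood S) :
    shift S ⊆ S := by
  rintro _ ⟨σ, hσ, rfl⟩
  exact S.add_mem hσ (isLeast_minElt hS).1.1

theorem IsLocalGood.inf_mem_shift {S : AddSubmonoid (ℕ × ℕ)} (hS : IsLocalGood S) {x y z w : ℕ}
    (hy : y ≤ w) (hx : x ≤ z) (h1 : (x, w) ∈ shift S) (h2 : (z, y) ∈ shift S) :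
    (x, y) ∈ shift S := by
  obtain ⟨⟨a, b⟩, h1, h1'⟩ := h1
  obtain ⟨⟨a', b'⟩, h2, h2'⟩ := h2
  refine ⟨_, hS.inf_mem _ h1 _ h2, ?_⟩
  simp only [Prod.ext_iff, Prod.fst_add, Prod.snd_add, Prod.mk_inf_mk] at h1' h2' ⊢
  omega

/-! ### Jumps and the height function -/

open Classical in
/-- `1` if the vertical half-line above `(x, y)` meets `S` but not `S + e`, otherwise `0`. -/
noncomputable def vertJump (S : AddSubmonoid (ℕ × ℕ)) (x y : ℕ) : ℕ :=
  if MeetsVert S x y ∧ ¬ MeetsVert (shift S) x y then 1 else 0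

open Classical in
/-- `1` if the horizontal half-line to the right of `(x, y)` meets `S` but not `S + e`,
otherwise `0`. -/
noncomputable def horzJump (S : AddSubmonoid (ℕ × ℕ)) (x y : ℕ) : ℕ :=
  if MeetsHorz S x y ∧ ¬ MeetsHorz (shift S) x y then 1 else 0

theorem vertJump_le_one (S : AddSubmonoid (ℕ × ℕ)) (x y : ℕ) : vertJump S x y ≤ 1 := by
  unfold vertJump
  split_ifs <;> omega

theorem horzJump_le_one (S : AddSubmonoid (ℕ × ℕ)) (x y : ℕ) : horzJump S x y ≤ 1 := by
  unfold horzJump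
  split_ifs <;> omega

theorem vertJump_pos {S : AddSubmonoid (ℕ × ℕ)} {x y : ℕ} :
    0 < vertJump S x y ↔ MeetsVert S x y ∧ ¬ MeetsVert (shift S) x y := by
  unfold vertJump
  split_ifs with h
  · simp [h]
  · simp [h]

theorem horzJump_pos {S : AddSubmonoid (ℕ × ℕ)} {x y : ℕ} :
    0 < horzJump S x y ↔ MeetsHorz S x y ∧ ¬ MeetsHorz (shift S) x y := by
  unfold horzJump
  split_ifs with h
  · simp [h]
  · simp [h]

/-- As `S + e ⊆ S`, each jump is a difference of two indicators; subtract the two instances of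
`step_comm`. -/
theorem IsLocalGood.jump_comm {S : AddSubmonoid (ℕ × ℕ)} (hS : IsLocalGood S) (x y : ℕ) :
    vertJump S x y + horzJump S (x + 1) y = horzJump S x y + vertJump S x (y + 1) := by
  classical
  have h1 := hS.exchange.step_comm x y
  have h2 := hS.exchange_shift.step_comm x y
  have hV : ∀ u v, (if MeetsVert (shift S) u v then 1 else 0) + vertJump S u v =
      if MeetsVert S u v then 1 else 0 := fun u v => by
    have : MeetsVert (shift S) u v → MeetsVert S u v :=
      fun ⟨z, hz, h⟩ => ⟨z, hz, hS.shift_subset h⟩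
    unfold vertJump
    by_cases ha : MeetsVert (shift S) u v
    · simp [ha, this ha]
    · simp [ha]
  have hH : ∀ u v, (if MeetsHorz (shift S) u v then 1 else 0) + horzJump S u v =
      if MeetsHorz S u v then 1 else 0 := fun u v => by
    have : MeetsHorz (shift S) u v → MeetsHorz S u v :=
      fun ⟨z, hz, h⟩ => ⟨z, hz, hS.shift_subset h⟩
    unfold horzJump
    by_cases ha : MeetsHorz (shift S) u v
    · simp [ha, this ha]
    · simp [ha]
  have a1 := hV x y
  have a2 := hV x (y + 1)
  have a3 := hH x y
  have a4 := hH (x + 1) y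
  omega

/-- The height of a point of `ℕ²`: the number of jumps on a lattice path from the origin to it. -/
noncomputable def height (S : AddSubmonoid (ℕ × ℕ)) (p : ℕ × ℕ) : ℕ :=
  ∑ x ∈ Finset.range p.1, vertJump S x 0 + ∑ y ∈ Finset.range p.2, horzJump S p.1 y

theorem height_zero (S : AddSubmonoid (ℕ × ℕ)) : height S 0 = 0 := by
  simp [height]

theorem height_succ_snd (S : AddSubmonoid (ℕ × ℕ)) (x y : ℕ) :
    height S (x, y + 1) = height S (x, y) + horzJump S x y := by
  simp [height, Finset.sum_range_succ, add_assoc]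

theorem IsLocalGood.height_succ_fst {S : AddSubmonoid (ℕ × ℕ)} (hS : IsLocalGood S) (x y : ℕ) :
    height S (x + 1, y) = height S (x, y) + vertJump S x y := by
  induction y with
  | zero => simp [height, Finset.sum_range_succ]
  | succ y ih =>
    have := hS.jump_comm x y
    rw [height_succ_snd, height_succ_snd, ih]
    omega

theorem IsLocalGood.height_mono {S : AddSubmonoid (ℕ × ℕ)} (hS : IsLocalGood S) :
    Monotone (height S) := by
  rintro ⟨a, b⟩ ⟨c, d⟩ ⟨h1, h2⟩
  have m1 : Monotone fun x => height S (x, b) :=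
    monotone_nat_of_le_succ fun x => by rw [hS.height_succ_fst]; omega
  have m2 : Monotone fun y => height S (c, y) :=
    monotone_nat_of_le_succ fun y => by rw [height_succ_snd]; omega
  exact (m1 h1).trans (m2 h2)

/-! ### Intermediate values and the maximal height -/

/-- The height takes every intermediate value on the Apéry set, below any element of `S`. -/
theorem IsLocalGood.exists_mem_apery_height_eq {S : AddSubmonoid (ℕ × ℕ)} (hS : IsLocalGood S)
    {q z : ℕ × ℕ} (hz : z ∈ S) (hqz : q ≤ z) {c : ℕ} (hq : height S q ≤ c)
    (hc : c < height S z) : ∃ p ∈ apery S, q ≤ p ∧ p ≤ z ∧ height S p = c := by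
  have hfin : {p | p ∈ Set.Icc q z ∧ height S p ≤ c}.Finite :=
    (Set.finite_Icc q z).subset fun p hp => hp.1
  -- By maximality, any unit step that stays below `z` must push the height past `c`, hence is a
  -- jump.
  obtain ⟨⟨x, y⟩, ⟨⟨hqp, hpz⟩, hpc⟩, hmax⟩ := hfin.exists_maximal ⟨q, ⟨le_rfl, hqz⟩, hq⟩
  obtain ⟨z1, z2⟩ := z
  have hz1 : x ≤ z1 := hpz.1
  have hz2 : y ≤ z2 := hpz.2
  have hV : x < z1 → 0 < vertJump S x y ∧ height S (x, y) = c := fun hlt => by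
    have hgt : ¬ height S (x + 1, y) ≤ c := fun h => by
      have hle : (x, y) ≤ (x + 1, y) := ⟨Nat.le_succ x, le_rfl⟩
      exact absurd (hmax ⟨⟨hqp.trans hle, hlt, hz2⟩, h⟩ hle).1 (Nat.not_succ_le_self x)
    have h1 := hS.height_succ_fst x y
    have h2 := vertJump_le_one S x y
    omega
  have hH : y < z2 → 0 < horzJump S x y ∧ height S (x, y) = c := fun hlt => by
    have hgt : ¬ height S (x, y + 1) ≤ c := fun h => by
      have hle : (x, y) ≤ (x, y + 1) := ⟨le_rfl, Nat.le_succ y⟩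
      exact absurd (hmax ⟨⟨hqp.trans hle, hz1, hlt⟩, h⟩ hle).2 (Nat.not_succ_le_self y)
    have h1 := height_succ_snd S x y
    have h2 := horzJump_le_one S x y
    omega
  have hlt : x < z1 ∨ y < z2 := by
    by_contra! h
    obtain rfl : x = z1 := le_antisymm hz1 h.1
    obtain rfl : y = z2 := le_antisymm hz2 h.2
    omega
  -- Both half-lines from `(x, y)` meet `S`, at `z` or because of a jump, so `inf_mem` puts `(x, y)`
  -- in `S`.
  have hVS : ∃ w, y ≤ w ∧ (x, w) ∈ S := by
    rcases hz1.eq_or_lt with rfl | h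
    · exact ⟨z2, hz2, hz⟩
    · exact (vertJump_pos.1 (hV h).1).1
  have hHS : ∃ w, x ≤ w ∧ (w, y) ∈ S := by
    rcases hz2.eq_or_lt with rfl | h
    · exact ⟨z1, hz1, hz⟩
    · exact (horzJump_pos.1 (hH h).1).1
  have hmem : (x, y) ∈ S := by
    obtain ⟨w, hw, h1⟩ := hVS
    obtain ⟨w', hw', h2⟩ := hHS
    simpa [hw, hw'] using hS.inf_mem _ h1 _ h2
  refine ⟨(x, y), mem_apery.2 ⟨hmem, fun hE => ?_⟩, hqp, hpz, ?_⟩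
  · rcases hlt with h | h
    · exact (vertJump_pos.1 (hV h).1).2 ⟨y, le_rfl, hE⟩
    · exact (horzJump_pos.1 (hH h).1).2 ⟨x, le_rfl, hE⟩
  · exact hlt.elim (fun h => (hV h).2) fun h => (hH h).2

/-- The height attains its maximum on a translate of `ℕ²` contained in `S`. -/
theorem IsLocalGood.exists_height_eq {S : AddSubmonoid (ℕ × ℕ)} (hS : IsLocalGood S) :
    ∃ (n : ℕ) (k : ℕ × ℕ), ∀ p, k ≤ p → p ∈ S ∧ height S p = n := by
  obtain ⟨c, -, hc⟩ := hS.exists_conductor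
  have hE : ∀ p, c + minElt S ≤ p → p ∈ shift S := fun p hp => by
    obtain ⟨δ, rfl⟩ := exists_add_of_le hp
    exact ⟨c + δ, hc δ, by abel⟩
  refine ⟨height S (c + minElt S), c + minElt S, fun p hp => ⟨hS.shift_subset (hE p hp), ?_⟩⟩
  refine le_antisymm ?_ (hS.height_mono hp)
  -- A larger height would yield an Apéry element beyond `c + e`, where everything lies in `S + e`.
  by_contra! h
  generalize hk : c + minElt S = k at *
  obtain ⟨β, hβ, hkβ, -, -⟩ :=
    hS.exists_mem_apery_height_eq (hS.shift_subset (hE p hp)) hp le_rfl h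
  exact hβ.2 (hE β hkβ)

/-! ### Height against the order on the Apéry set -/

/-- Without a jump both half-lines would meet `S + e`, and the infimum of the two points is `(x,
y)`. -/
theorem IsLocalGood.jump_of_mem_apery {S : AddSubmonoid (ℕ × ℕ)} (hS : IsLocalGood S) {x y : ℕ}
    (h : (x, y) ∈ apery S) : 0 < vertJump S x y ∨ 0 < horzJump S x y := by
  rw [vertJump_pos, horzJump_pos]
  by_contra! hn
  obtain ⟨w, hw, h1⟩ := hn.1 ⟨y, le_rfl, h.1⟩
  obtain ⟨w', hw', h2⟩ := hn.2 ⟨x, le_rfl, h.1⟩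
  exact h.2 (hS.inf_mem_shift hw hw' h1 h2)

/-- One of the two unit steps out of `α` is a jump; `β` lies beyond the right one, `γ` beyond the
upper one. -/
theorem IsLocalGood.height_lt_max {S : AddSubmonoid (ℕ × ℕ)} (hS : IsLocalGood S) {α β γ : ℕ × ℕ}
    (hα : α ∈ apery S) (h1 : α.1 + 1 ≤ β.1) (h1' : α.2 ≤ β.2) (h2 : α.1 ≤ γ.1)
    (h2' : α.2 + 1 ≤ γ.2) : height S α < height S β ∨ height S α < height S γ := by
  obtain ⟨x, y⟩ := α
  have hβ : height S (x + 1, y) ≤ height S β := hS.height_mono ⟨h1, h1'⟩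
  have hγ : height S (x, y + 1) ≤ height S γ := hS.height_mono ⟨h2, h2'⟩
  rw [hS.height_succ_fst] at hβ
  rw [height_succ_snd] at hγ
  rcases hS.jump_of_mem_apery hα with h | h
  · left; omega
  · right; omega

theorem IsLocalGood.height_lt_of_strictDom {S : AddSubmonoid (ℕ × ℕ)} (hS : IsLocalGood S)
    {α β : ℕ × ℕ} (hα : α ∈ apery S) (h : StrictDom α β) : height S α < height S β :=
  (or_self_iff).1 (hS.height_lt_max hα h.1 h.2.le h.1.le h.2)

theorem IsLocalGood.height_lt {S : AddSubmonoid (ℕ × ℕ)} (hS : IsLocalGood S) {n : ℕ}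
    {k : ℕ × ℕ} (hk : ∀ p, k ≤ p → p ∈ S ∧ height S p = n) {α : ℕ × ℕ} (hα : α ∈ apery S) :
    height S α < n := by
  have h := hS.height_lt_of_strictDom (β := (k ⊔ α) + (1, 1)) hα
    ⟨Nat.lt_succ_of_le le_sup_right, Nat.lt_succ_of_le le_sup_right⟩
  rwa [(hk _ (le_sup_left.trans le_self_add)).2] at h

/-! ### Layers as fibres of the height -/

/-- The elements of the Apéry set of height less than `m + 1` have those of height `m` as
top part. -/
theorem IsLocalGood.topPart_height_lt {S : AddSubmonoid (ℕ × ℕ)} (hS : IsLocalGood S) {n : ℕ}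
    {k : ℕ × ℕ} (hk : ∀ p, k ≤ p → p ∈ S ∧ height S p = n) {m : ℕ} (hm : m < n) :
    topPart {α | α ∈ apery S ∧ height S α ≤ m} = {α | α ∈ apery S ∧ height S α = m} := by
  ext ⟨x, y⟩
  constructor
  · rintro ⟨hmaxl, hninf⟩
    obtain ⟨⟨hα, hle⟩, hmax⟩ := mem_maximalPart.1 hmaxl
    refine ⟨hα, hle.antisymm ?_⟩
    by_contra! hlt
    have v1 := hS.height_succ_fst x y
    have v2 := hS.height_succ_fst x (y + 1)
    have w1 := height_succ_snd S x y
    have w2 := height_succ_snd S (x + 1) y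
    have b1 := vertJump_le_one S x y
    have b2 := vertJump_le_one S x (y + 1)
    have b3 := horzJump_le_one S x y
    have b4 := horzJump_le_one S (x + 1) y
    -- If the diagonal step gains at most 1, some Apéry element of height one more strictly
    -- dominates `(x, y)`, against maximality.
    by_cases hstep : height S (x + 1, y + 1) ≤ height S (x, y) + 1
    · obtain ⟨p, hp, hqp, -, hph⟩ := hS.exists_mem_apery_height_eq
        (z := k ⊔ (x + 1, y + 1)) (hk _ le_sup_left).1 le_sup_right hstep
        (by rw [(hk _ le_sup_left).2]; omega)
      exact hmax p ⟨hp, by omega⟩ hqp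
    -- The diagonal step gains 2, so all four sides of the unit square are jumps. This gives maximal
    -- elements straight above and straight to the right of `(x, y)`, whose infimum it is.
    · obtain ⟨⟨z2, hz2, hzS⟩, hzE⟩ := vertJump_pos.1 (show 0 < vertJump S x (y + 1) by omega)
      obtain ⟨⟨z1, hz1, hzS'⟩, hzE'⟩ := horzJump_pos.1 (show 0 < horzJump S (x + 1) y by omega)
      have key : ∀ z q : ℕ × ℕ, z ∈ apery S → q ≤ z → height S q = height S (x, y) + 1 →
          ∃ p ∈ apery S, q ≤ p ∧ p ≤ z ∧ height S p = height S (x, y) + 1 := by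
        intro z q hz hqz hq
        rcases (hS.height_mono hqz).eq_or_lt with h | h
        · exact ⟨z, hz, hqz, le_rfl, h.symm.trans hq⟩
        · exact hS.exists_mem_apery_height_eq hz.1 hqz hq.le (hq ▸ h)
      obtain ⟨⟨a, b⟩, hp, ⟨ha, hb⟩, ⟨ha', -⟩, hph⟩ := key (x, z2) (x, y + 1)
        (mem_apery.2 ⟨hzS, fun h => hzE ⟨z2, hz2, h⟩⟩) ⟨le_rfl, hz2⟩ (by omega)
      obtain ⟨⟨a', b'⟩, hp', ⟨hc, hd⟩, ⟨-, hd'⟩, hph'⟩ := key (z1, y) (x + 1, y)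
        (mem_apery.2 ⟨hzS', fun h => hzE' ⟨z1, hz1, h⟩⟩) ⟨hz1, le_rfl⟩ (by omega)
      dsimp only at ha hb ha' hc hd hd'
      refine hninf ⟨hmaxl, (a, b), ⟨mem_maximalPart.2 ⟨⟨hp, by omega⟩, ?_⟩, ?_⟩, (a', b'),
        ⟨mem_maximalPart.2 ⟨⟨hp', by omega⟩, ?_⟩, ?_⟩, ?_⟩
      · exact fun β hβ hd => hmax β hβ ⟨ha.trans_lt hd.1, (Nat.le_of_succ_le hb).trans_lt hd.2⟩
      · simp only [Set.mem_singleton_iff, Prod.ext_iff]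
        omega
      · exact fun β hβ he => hmax β hβ ⟨(Nat.le_of_succ_le hc).trans_lt he.1, hd.trans_lt he.2⟩
      · simp only [Set.mem_singleton_iff, Prod.ext_iff]
        omega
      · simp only [Prod.mk_inf_mk, Prod.ext_iff]
        omega
  · rintro ⟨hα, hh⟩
    refine ⟨mem_maximalPart.2 ⟨⟨hα, hh.le⟩, fun β hβ hd => ?_⟩, ?_⟩
    · have := hS.height_lt_of_strictDom hα hd
      have := hβ.2
      omega
    · rintro ⟨-, ⟨a, b⟩, ⟨hβ, hβα⟩, ⟨a', b'⟩, ⟨hγ, hγα⟩, hinf⟩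
      have h1 := hβ.1.2
      have h2 := hγ.1.2
      simp only [Set.mem_singleton_iff, Prod.ext_iff, Prod.mk_inf_mk] at hβα hγα hinf
      -- One of the two elements lies to the right of `(x, y)` and the other above it; one of them
      -- is then too high.
      rcases Nat.lt_or_ge x a with hxa | hxa
      · have := hS.height_lt_max (β := (a, b)) (γ := (a', b')) hα (by dsimp only; omega)
          (by dsimp only; omega) (by dsimp only; omega) (by dsimp only; omega)
        omega
      · have := hS.height_lt_max (β := (a', b')) (γ := (a, b)) hα (by dsimp only; omega)
          (by dsimp only; omega) (by dsimp only; omega) (by dsimp only; omega)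
        omega

theorem IsLocalGood.residual_eq_height {S : AddSubmonoid (ℕ × ℕ)} (hS : IsLocalGood S) {n : ℕ}
    {k : ℕ × ℕ} (hk : ∀ p, k ≤ p → p ∈ S ∧ height S p = n) (j : ℕ) :
    residual S j = {α | α ∈ apery S ∧ height S α + j < n} := by
  induction j with
  | zero => exact Set.ext fun α => ⟨fun h => ⟨h, hS.height_lt hk h⟩, fun h => h.1⟩
  | succ j ih =>
    change residual S j \ topPart (residual S j) = _
    rcases Nat.lt_or_ge j n with hj | hj
    · have h : residual S j = {α | α ∈ apery S ∧ height S α ≤ n - 1 - j} := by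
        rw [ih]
        ext α
        exact and_congr_right fun _ => by omega
      rw [h, hS.topPart_height_lt hk (by omega)]
      ext α
      simp only [Set.mem_sdiff, Set.mem_ofPred_eq, not_and]
      constructor
      · rintro ⟨⟨h1, h2⟩, h3⟩
        have := h3 h1
        exact ⟨h1, by omega⟩
      · rintro ⟨h1, h2⟩
        exact ⟨⟨h1, by omega⟩, fun _ => by omega⟩
    · ext α
      constructor
      · intro h
        have h' := h.1
        rw [ih] at h'
        have := h'.2
        omega
      · rintro ⟨-, h⟩
        omega

/-- The layers are the fibres of the height on the Apéry set. -/
theorem IsLocalGood.mem_layer_succ {S : AddSubmonoid (ℕ × ℕ)} (hS : IsLocalGood S) {n : ℕ}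
    {k : ℕ × ℕ} (hk : ∀ p, k ≤ p → p ∈ S ∧ height S p = n) (j : ℕ) (α : ℕ × ℕ) :
    α ∈ layer S (j + 1) ↔ α ∈ apery S ∧ height S α + j + 1 = n := by
  have hres := hS.residual_eq_height hk
  have h : layer S (j + 1) = residual S j \ residual S (j + 1) := by
    change topPart (residual S j) = residual S j \ (residual S j \ topPart (residual S j))
    rw [Set.sdiff_sdiff_cancel_left]
    exact fun x hx => hx.1.1
  rw [h, hres, hres]
  simp only [Set.mem_sdiff, Set.mem_ofPred_eq, not_and]
  constructor
  · rintro ⟨⟨h1, h2⟩, h3⟩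
    have := h3 h1
    exact ⟨h1, by omega⟩
  · rintro ⟨h1, h2⟩
    exact ⟨⟨h1, by omega⟩, fun _ => by omega⟩

theorem IsLocalGood.numLevels_le {S : AddSubmonoid (ℕ × ℕ)} (hS : IsLocalGood S) {n : ℕ}
    {k : ℕ × ℕ} (hk : ∀ p, k ≤ p → p ∈ S ∧ height S p = n) : numLevels S ≤ n := by
  refine Nat.sInf_le (Set.Subset.antisymm (fun α hα => ?_) ?_)
  · have h := hS.height_lt hk hα
    refine Set.mem_iUnion₂.2 ⟨n - 1 - height S α + 1, Finset.mem_Icc.2 ⟨by omega, by omega⟩, ?_⟩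
    exact (hS.mem_layer_succ hk _ α).2 ⟨hα, by omega⟩
  · refine Set.iUnion₂_subset fun j _ => ?_
    cases j with
    | zero => exact Set.empty_subset _
    | succ j => exact fun α hα => ((hS.mem_layer_succ hk j α).1 hα).1

end GoodSemigroup

theorem proposition3p5 (S : AddSubmonoid (ℕ × ℕ)) (hS : GoodSemigroup.IsLocalGood S)
    (i : ℕ) (hi : 2 ≤ i) (α : ℕ × ℕ) (hα : α ∈ GoodSemigroup.level S i) :
    ∃ β ∈ GoodSemigroup.level S (i - 1), β ≤ α := by
  obtain ⟨n, k, hk⟩ := hS.exists_height_eq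
  have hN := hS.numLevels_le hk
  unfold GoodSemigroup.level at hα ⊢
  generalize GoodSemigroup.numLevels S = N at *
  obtain ⟨j, hj⟩ | hj : (∃ j, N + 1 - i = j + 1) ∨ N + 1 - i = 0 := by
    rcases N + 1 - i with _ | j
    · exact Or.inr rfl
    · exact Or.inl ⟨j, rfl⟩
  · rw [hj, hS.mem_layer_succ hk] at hα
    obtain ⟨hαS, hh⟩ := hα
    -- `N ≤ n` and `2 ≤ i` give `j + 2 ≤ n`, so the subtraction is not truncated.
    obtain ⟨β, hβ, -, hle, hβh⟩ := hS.exists_mem_apery_height_eq (q := 0)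
      (c := n - (j + 2)) hαS.1 ⟨Nat.zero_le _, Nat.zero_le _⟩
      (by rw [GoodSemigroup.height_zero]; omega) (by omega)
    refine ⟨β, ?_, hle⟩
    rw [show N + 1 - (i - 1) = j + 1 + 1 by omega]
    exact (hS.mem_layer_succ hk _ β).2 ⟨hβ, by omega⟩
  -- Here `i > N`, and `layer S 0` is empty.
  · rw [hj] at hα
    exact absurd hα (Set.notMem_empty α)
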